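/- Let $k$ be a nonzero commutative ring, $\mathcal V$ a finite set (colors of vertices) and $\mathcal F$ a set (colors of flags). **Diagrams.** A colored graph $\Gamma$ consists of finite sets $\mathrm{vert}(\Gamma)$ (vertices) and $\mathrm{flag}(\Gamma)$ (flags), maps $o:\mathrm{flag}(\Gamma)\to\mathrm{vert}(\Gamma)$ and $s:\mathrm{flag}(\Gamma)\to\mathrm{flag}(\Gamma)$ with $s^2=\mathrm{id}$, and coloring maps $\mathrm{vert}(\Gamma)\to\mathcal V$, $\mathrm{flag}(\Gamma)\to\mathcal F$. It is enumerated by a bijection $\nu:\mathrm{vert}(\Gamma)\to\{1,\dots,n\}$. For $n\ge 1$ let $\mathrm{Dgm}(n)$ be the set of isomorphism classes of enumerated colored graphs with $n$ vertices (isomorphisms commute with $o$ and $s$ and preserve colors and enumeration); $S_n$ acts on it by renumbering the vertices. Let $\emptyset\ne J\subseteq\mathrm{vert}(\Gamma)$ and $L\in\mathcal V$. * $\Gamma_J$ is the enumerated colored graph with vertex set $J$, flag set $o^{-1}(J)$, the restricted map $o$ and colorings, and $s_J(f)=s(f)$ if $s(f)\in o^{-1}(J)$, $s_J(f)=f$ otherwise;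 it is enumerated increasingly by $\{1,\dots,|J|\}$. * $\Gamma/(J,L)$ is the enumerated colored graph with vertex set $(\mathrm{vert}(\Gamma)\setminus J)\cup\{v_J\}$, where $v_J$ is a new vertex of color $L$; its flags are those of $\Gamma$ except the flags $f\ne s(f)$ with $o(f),o(s(f))\in J$; flags attached to $J$ become attached to $v_J$, and everything else is restricted from $\Gamma$. It is enumerated increasingly by $\{1,\dots,n-|J|+1\}$, where $v_J$ is given the number $\min\nu(J)$. **The operad $U$.** Let $U(n)=k^{\mathrm{Dgm}(n)\times\mathcal V}$ for $n\ge1$, with the action of $S_n$ induced by that on $\mathrm{Dgm}(n)$, and with the partial compositions $\circ_i:U(n)\otimes U(j)\to U(n-1+j)$, $1\le i\le n$, $j\ge 1$, $$(q''\circ_i q')(\Gamma,K)=\sum_{L\in\mathcal V}q'(\Gamma_J,L)\,q''(\Gamma/(J,L),K),\qquad J=\nu^{-1}(\{i,i+1,\dots,i+j-1\}).$$ A system of submodules $P(n)\subseteq U(n)$, $n\ge1$, is called a suboperad of $U$ if each $P(n)$ is stable under $S_n$ and $q''\circ_i q'\in P(n-1+j)$ for all $q''\in P(n)$, $q'\in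 P(j)$, $1\le i\le n$ (no operadic unit is required). **Proposition.** Let $\mathcal S(n)\subseteq\mathrm{Dgm}(n)\times\mathcal V$, $n\ge1$, be a system of subsets, and let $$U_{\mathcal S}(n)=k^{\mathcal S(n)}=\{q\in U(n)\mid q(x)=0\text{ for all }x\notin\mathcal S(n)\}.$$ Then the following are equivalent: 1. $\{U_{\mathcal S}(n)\}_{n\ge1}$ is a suboperad of $U$. 2. Each $\mathcal S(n)$ is $S_n$-invariant (for the action on the factor $\mathrm{Dgm}(n)$), and for every $n\ge1$, every enumerated colored graph $\Gamma$ with $n$ vertices, every nonempty $J\subseteq\mathrm{vert}(\Gamma)$ and all $K,L\in\mathcal V$, $$(\Gamma_J,L)\in\mathcal S(|J|)\ \text{ and }\ (\Gamma/(J,L),K)\in\mathcal S(n-|J|+1)\ \Longrightarrow\ (\Gamma,K)\in\mathcal S(n).$$ -/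

import Mathlib

universe u v w

namespace Contraction

/-! ### Enumerated colored graphs -/

/-- An enumerated colored graph with `n` vertices: a set `V` of vertices, a finite set `F` of flags
(half-edges), the map `att` attaching each flag to a vertex, the involution `join` joining flags
(`join f = f` means that `f` is an external line, otherwise `{f, join f}` is an internal line),
colors of vertices and of flags, and an enumeration of the vertices.
Labels `1, …, n` are modelled by `Fin n`, i.e. shifted down by one. Tadpoles are allowed. -/
structure Diagram (VCol : Type u) (FCol : Type v) (n : ℕ) where
  V : Type
  F : Type
  finite_F : Finite F
  att : F → V
  join : F → F
  join_join : ∀ f, join (join f) = f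
  vcol : V → VCol
  fcol : F → FCol
  enu : V ≃ Fin n

namespace Diagram

variable {VCol : Type u} {FCol : Type v}

/-- Isomorphisms of enumerated colored graphs: they commute with the structure maps and preserve
the colors and the enumeration. -/
structure Iso {n : ℕ} (G G' : Diagram VCol FCol n) where
  onV : G.V ≃ G'.V
  onF : G.F ≃ G'.F
  att_comm : ∀ f, G'.att (onF f) = onV (G.att f)
  join_comm : ∀ f, G'.join (onF f) = onF (G.join f)
  vcol_comm : ∀ x, G'.vcol (onV x) = G.vcol x
  fcol_comm : ∀ f, G'.fcol (onF f) = G.fcol f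
  enu_comm : ∀ x, G'.enu (onV x) = G.enu x

/-- The relation of being isomorphic. -/
instance setoid (VCol : Type u) (FCol : Type v) (n : ℕ) : Setoid (Diagram VCol FCol n) where
  r G G' := Nonempty (Iso G G')
  iseqv :=
    { refl := fun G => ⟨⟨Equiv.refl _, Equiv.refl _, fun _ => rfl, fun _ => rfl, fun _ => rfl,
        fun _ => rfl, fun _ => rfl⟩⟩
      symm := by
        rintro G G' ⟨e⟩
        refine ⟨⟨e.onV.symm, e.onF.symm, fun f => ?_, fun f => ?_, fun x => ?_, fun f => ?_,
          fun x => ?_⟩⟩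
        · rw [Equiv.eq_symm_apply, ← e.att_comm, Equiv.apply_symm_apply]
        · rw [Equiv.eq_symm_apply, ← e.join_comm, Equiv.apply_symm_apply]
        · rw [← e.vcol_comm, Equiv.apply_symm_apply]
        · rw [← e.fcol_comm, Equiv.apply_symm_apply]
        · rw [← e.enu_comm, Equiv.apply_symm_apply]
      trans := by
        rintro G G' G'' ⟨e⟩ ⟨e'⟩
        refine ⟨⟨e.onV.trans e'.onV, e.onF.trans e'.onF, fun f => ?_, fun f => ?_, fun x => ?_,
          fun f => ?_, fun x => ?_⟩⟩ <;>
        simp [e.att_comm, e'.att_comm, e.join_comm, e'.join_comm, e.vcol_comm, e'.vcol_comm,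
          e.fcol_comm, e'.fcol_comm, e.enu_comm, e'.enu_comm] }

end Diagram

open Classical in
/-- If the elements of a set `T` with `m` elements carry distinct labels in `Fin n`, this is the
enumeration of `T` by `Fin m` which is increasing with respect to the labels. -/
noncomputable def rankEquiv {T : Type} {n m : ℕ} (lab : T → Fin n)
    (hlab : Function.Injective lab) (hT : Nat.card T = m) : T ≃ Fin m :=
  (Equiv.ofInjective lab hlab).trans
    (monoEquivOfFin (Set.range lab)
      (by rw [← Nat.card_eq_fintype_card, ← Nat.card_congr (Equiv.ofInjective lab hlab), hT])
      ).symm.toEquiv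

theorem rankEquiv_strictMono {T : Type} {n m : ℕ} (lab : T → Fin n)
    (hlab : Function.Injective lab) (hT : Nat.card T = m) {s t : T} :
    rankEquiv lab hlab hT s < rankEquiv lab hlab hT t ↔ lab s < lab t := by
  classical
  exact (OrderIso.lt_iff_lt (monoEquivOfFin (Set.range lab)
    (by rw [← Nat.card_eq_fintype_card, ← Nat.card_congr (Equiv.ofInjective lab hlab), hT])
    ).symm (x := Equiv.ofInjective lab hlab s) (y := Equiv.ofInjective lab hlab t))

theorem rankEquiv_congr {T T' : Type} {n m : ℕ} (lab : T → Fin n) (lab' : T' → Fin n)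
    (hlab : Function.Injective lab) (hlab' : Function.Injective lab') (hT : Nat.card T = m)
    (hT' : Nat.card T' = m) (e : T ≃ T') (he : ∀ t, lab' (e t) = lab t) (t : T) :
    rankEquiv lab' hlab' hT' (e t) = rankEquiv lab hlab hT t := by
  have hlt : ∀ a b : Fin m, a < b ↔
      (((rankEquiv lab hlab hT).symm.trans e).trans (rankEquiv lab' hlab' hT')) a <
      (((rankEquiv lab hlab hT).symm.trans e).trans (rankEquiv lab' hlab' hT')) b := by
    intro a b
    simp only [Equiv.trans_apply, rankEquiv_strictMono, he]
    rw [← rankEquiv_strictMono lab hlab hT, Equiv.apply_symm_apply, Equiv.apply_symm_apply]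
  have hmono : StrictMono
      (((rankEquiv lab hlab hT).symm.trans e).trans (rankEquiv lab' hlab' hT')) :=
    fun a b hab => (hlt a b).1 hab
  have key := Subsingleton.elim
    (hmono.orderIsoOfSurjective _ (Equiv.surjective _)) (OrderIso.refl (Fin m))
  have := congrArg (fun o : Fin m ≃o Fin m => o (rankEquiv lab hlab hT t)) key
  simpa using this

namespace Diagram

variable {VCol : Type u} {FCol : Type v}

open Classical in
/-- The enumerated colored graph `Γ_J` determined by a set `J` of `m` vertices of `Γ`. Its flags are
those attached to `J`; two of them are joined if they are joined in `Γ`. The enumeration is the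
increasing one. -/
noncomputable def restrict {n m : ℕ} (G : Diagram VCol FCol n) (J : Finset G.V)
    (hm : J.card = m) : Diagram VCol FCol m where
  V := {x : G.V // x ∈ J}
  F := {f : G.F // G.att f ∈ J}
  finite_F := haveI := G.finite_F; inferInstance
  att f := ⟨G.att f.1, f.2⟩
  join f := if h : G.att (G.join f.1) ∈ J then ⟨G.join f.1, h⟩ else f
  join_join := by
    rintro ⟨f, hf⟩
    by_cases h : G.att (G.join f) ∈ J
    · simp [h, G.join_join, hf]
    · simp [h]
  vcol x := G.vcol x.1
  fcol f := G.fcol f.1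
  enu := rankEquiv (fun x : {x : G.V // x ∈ J} => G.enu x.1)
    (fun _ _ h => Subtype.ext (G.enu.injective h)) (by simp [hm])

/-- The label of a vertex of a contracted graph: `none` stands for the new vertex `v_J`, whose label
is the least label occurring in `J`; the vertices outside `J` keep their labels. -/
def contractLabel {n : ℕ} (G : Diagram VCol FCol n) (J : Finset G.V) (hJ : J.Nonempty) :
    Option {x : G.V // x ∉ J} → Fin n
  | none => (J.map G.enu.toEmbedding).min' (hJ.map)
  | some x => G.enu x.1

theorem contractLabel_injective {n : ℕ} (G : Diagram VCol FCol n) (J : Finset G.V)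
    (hJ : J.Nonempty) : Function.Injective (contractLabel G J hJ) := by
  have key : ∀ x : {x : G.V // x ∉ J},
      (J.map G.enu.toEmbedding).min' (hJ.map) ≠ G.enu x.1 := by
    intro x h
    have := Finset.min'_mem (J.map G.enu.toEmbedding) hJ.map
    rw [h] at this
    exact x.2 (by simpa using this)
  rintro (_ | x) (_ | y) h
  · rfl
  · exact absurd h (key y)
  · exact absurd h.symm (key x)
  · exact congrArg some (Subtype.ext (G.enu.injective h))

theorem card_contract {n m : ℕ} (G : Diagram VCol FCol n) (J : Finset G.V)
    (hm : m + J.card = n + 1) : Nat.card (Option {x : G.V // x ∉ J}) = m := by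
  classical
  have : Fintype G.V := Fintype.ofEquiv _ G.enu.symm
  have h1 : Fintype.card G.V = n := by simpa using Fintype.card_congr G.enu
  have h2 : J.card ≤ Fintype.card G.V := Finset.card_le_univ J
  have h3 : Fintype.card {x : G.V // x ∉ J} = Fintype.card G.V - J.card := by
    rw [Fintype.card_subtype_compl]
    simp
  rw [Nat.card_eq_fintype_card, Fintype.card_option, h3]
  omega

open Classical in
/-- The contracted enumerated colored graph `Γ/(J,L)`: the vertices in `J` are shrunk to a single new
vertex `v_J = none` of color `L`, and the flags forming inner edges of `Γ_J` are removed. The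
enumeration is the increasing one, where `v_J` carries the least label occurring in `J`. The number
`m` of its vertices is `n - |J| + 1`. -/
noncomputable def contract {n m : ℕ} (G : Diagram VCol FCol n) (J : Finset G.V)
    (hJ : J.Nonempty) (L : VCol) (hm : m + J.card = n + 1) : Diagram VCol FCol m where
  V := Option {x : G.V // x ∉ J}
  F := {f : G.F // G.att f ∈ J ∧ G.att (G.join f) ∈ J → f = G.join f}
  finite_F := haveI := G.finite_F; inferInstance
  att f := if h : G.att f.1 ∈ J then none else some ⟨G.att f.1, h⟩
  join f := ⟨G.join f.1, by
    have h := f.2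
    rw [G.join_join]
    exact fun h' => (h ⟨h'.2, h'.1⟩).symm⟩
  join_join f := Subtype.ext (G.join_join f.1)
  vcol x := x.elim L (fun y => G.vcol y.1)
  fcol f := G.fcol f.1
  enu := rankEquiv (contractLabel G J hJ) (contractLabel_injective G J hJ) (card_contract G J hm)

theorem restrict_equiv {n m : ℕ} {G G' : Diagram VCol FCol n} (e : Iso G G') (J : Finset G.V)
    (J' : Finset G'.V) (h : ∀ x, e.onV x ∈ J' ↔ x ∈ J) (hm : J.card = m) (hm' : J'.card = m) :
    restrict G J hm ≈ restrict G' J' hm' := by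
  refine ⟨⟨e.onV.subtypeEquiv fun x => (h x).symm,
    e.onF.subtypeEquiv fun f => by rw [e.att_comm, h], ?_, ?_, ?_, ?_, ?_⟩⟩
  · rintro ⟨f, hf⟩
    exact Subtype.ext (e.att_comm f)
  · rintro ⟨f, hf⟩
    apply Subtype.ext
    by_cases hj : G.att (G.join f) ∈ J
    · have hj' : G'.att (G'.join (e.onF f)) ∈ J' := by
        rw [e.join_comm, e.att_comm, h]
        exact hj
      exact (congrArg Subtype.val (dif_pos hj')).trans ((e.join_comm f).trans
        (congrArg (fun g : {f : G.F // G.att f ∈ J} => e.onF g.1)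
          (dif_pos hj : (G.restrict J hm).join ⟨f, hf⟩ = ⟨G.join f, hj⟩).symm))
    · have hj' : G'.att (G'.join (e.onF f)) ∉ J' := by
        rw [e.join_comm, e.att_comm, h]
        exact hj
      exact (congrArg Subtype.val (dif_neg hj')).trans
        (congrArg (fun g : {f : G.F // G.att f ∈ J} => e.onF g.1)
          (dif_neg hj : (G.restrict J hm).join ⟨f, hf⟩ = ⟨f, hf⟩).symm)
  · rintro ⟨x, hx⟩
    exact e.vcol_comm x
  · rintro ⟨f, hf⟩
    exact e.fcol_comm f
  · intro x
    exact rankEquiv_congr (fun x : {x : G.V // x ∈ J} => G.enu x.1)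
      (fun x : {x : G'.V // x ∈ J'} => G'.enu x.1) _ _ (by simp [hm]) (by simp [hm']) _
      (fun t => e.enu_comm t.1) x

theorem contract_equiv {n m : ℕ} {G G' : Diagram VCol FCol n} (e : Iso G G') (J : Finset G.V)
    (J' : Finset G'.V) (h : ∀ x, e.onV x ∈ J' ↔ x ∈ J) (hJ : J.Nonempty) (hJ' : J'.Nonempty)
    (L : VCol) (hm : m + J.card = n + 1) (hm' : m + J'.card = n + 1) :
    contract G J hJ L hm ≈ contract G' J' hJ' L hm' := by
  refine ⟨⟨Equiv.optionCongr (e.onV.subtypeEquiv fun x => not_congr (h x).symm),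
    e.onF.subtypeEquiv fun f => by
      rw [e.join_comm, e.att_comm, e.att_comm, h, h, e.onF.injective.eq_iff], ?_, ?_, ?_, ?_, ?_⟩⟩
  · rintro ⟨f, hf⟩
    by_cases hj : G.att f ∈ J
    · have hj' : G'.att (e.onF f) ∈ J' := by
        rw [e.att_comm, h]
        exact hj
      exact (dif_pos hj').trans
        (congrArg (Option.map fun x : {x // x ∉ J} => (⟨e.onV x.1, by rw [h]; exact x.2⟩ :
          {x // x ∉ J'})) (dif_pos hj : (G.contract J hJ L hm).att ⟨f, hf⟩ = none).symm)
    · have hj' : G'.att (e.onF f) ∉ J' := by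
        rw [e.att_comm, h]
        exact hj
      exact (dif_neg hj').trans ((congrArg some (Subtype.ext (e.att_comm f))).trans
        (congrArg (Option.map fun x : {x // x ∉ J} => (⟨e.onV x.1, by rw [h]; exact x.2⟩ :
          {x // x ∉ J'})) (dif_neg hj : (G.contract J hJ L hm).att ⟨f, hf⟩ =
            some ⟨G.att f, hj⟩).symm))
  · rintro ⟨f, hf⟩
    exact Subtype.ext (e.join_comm f)
  · rintro (_ | x)
    · rfl
    · exact e.vcol_comm x.1
  · rintro ⟨f, hf⟩
    exact e.fcol_comm f
  · intro x
    refine rankEquiv_congr (contractLabel G J hJ) (contractLabel G' J' hJ')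
      (contractLabel_injective G J hJ) (contractLabel_injective G' J' hJ')
      (card_contract G J hm) (card_contract G' J' hm') _ ?_ x
    rintro (_ | y)
    · have hs : J'.map G'.enu.toEmbedding = J.map G.enu.toEmbedding := by
        ext l
        simp only [Finset.mem_map, Equiv.coe_toEmbedding]
        constructor
        · rintro ⟨x', hx', rfl⟩
          refine ⟨e.onV.symm x', ?_, ?_⟩
          · rw [← h, Equiv.apply_symm_apply]; exact hx'
          · rw [← e.enu_comm, Equiv.apply_symm_apply]
        · rintro ⟨x, hx, rfl⟩
          exact ⟨e.onV x, (h x).2 hx, e.enu_comm x⟩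
      simp [contractLabel, hs]
    · exact e.enu_comm y.1

/-- Renumbering of the vertices by a permutation. -/
def relabel {n : ℕ} (σ : Equiv.Perm (Fin n)) (G : Diagram VCol FCol n) : Diagram VCol FCol n :=
  { G with enu := G.enu.trans σ }

/-- The set of the `j` consecutive vertices with numbers `i, i + 1, …, i + j - 1`. -/
def segment {n : ℕ} (G : Diagram VCol FCol n) (i j : ℕ) : Finset G.V :=
  (Finset.univ.filter fun l : Fin n => i ≤ (l : ℕ) ∧ (l : ℕ) < i + j).map G.enu.symm.toEmbedding

theorem card_segment {n : ℕ} (G : Diagram VCol FCol n) (i j : ℕ) (h : i + j ≤ n) :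
    (G.segment i j).card = j := by
  rw [segment, Finset.card_map]
  have : (Finset.univ.filter fun l : Fin n => i ≤ (l : ℕ) ∧ (l : ℕ) < i + j).map
      Fin.valEmbedding = Finset.Ico i (i + j) := by
    ext a
    simp only [Finset.mem_map, Finset.mem_filter, Finset.mem_univ, true_and, Finset.mem_Ico,
      Fin.valEmbedding_apply]
    constructor
    · rintro ⟨l, hl, rfl⟩
      exact hl
    · intro ha
      exact ⟨⟨a, by omega⟩, ha, rfl⟩
  rw [← Finset.card_map Fin.valEmbedding, this]
  simp

theorem mem_segment {n : ℕ} (G : Diagram VCol FCol n) (i j : ℕ) (x : G.V) :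
    x ∈ G.segment i j ↔ i ≤ (G.enu x : ℕ) ∧ (G.enu x : ℕ) < i + j := by
  simp only [segment, Finset.mem_map, Finset.mem_filter, Finset.mem_univ, true_and,
    Equiv.coe_toEmbedding]
  constructor
  · rintro ⟨l, hl, rfl⟩
    simpa using hl
  · intro hx
    exact ⟨G.enu x, hx, by simp⟩

end Diagram

/-- `Dgm(n)`: the isomorphism classes of enumerated colored graphs with `n` vertices. -/
def Dgm (VCol : Type u) (FCol : Type v) (n : ℕ) : Type (max 1 u v) :=
  Quotient (Diagram.setoid VCol FCol n)

/-- The isomorphism class of an enumerated colored graph. -/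
def Diagram.toDgm {VCol : Type u} {FCol : Type v} {n : ℕ} (G : Diagram VCol FCol n) :
    Dgm VCol FCol n :=
  Quotient.mk _ G

/-- The action of the permutation group on `Dgm(n)`, by renumbering vertices. -/
instance {VCol : Type u} {FCol : Type v} {n : ℕ} :
    MulAction (Equiv.Perm (Fin n)) (Dgm VCol FCol n) where
  smul σ := Quotient.map (Diagram.relabel σ) (by
    rintro G G' ⟨e⟩
    exact ⟨⟨e.onV, e.onF, e.att_comm, e.join_comm, e.vcol_comm, e.fcol_comm,
      fun x => congrArg σ (e.enu_comm x)⟩⟩)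
  one_smul x := by
    induction x using Quotient.inductionOn
    rfl
  mul_smul σ τ x := by
    induction x using Quotient.inductionOn
    rfl

/-! ### The contraction operad -/

/-- The space `U(n)` of contraction maps of arity `n`. As `VCol` is finite, a linear map `Q` from the
free module on `Dgm(n)` to the free module on `VCol` is the same as the function `q` of its matrix
elements, `Q(Γ) = ∑ L, q(Γ,L) L`. -/
abbrev U (k : Type w) (VCol : Type u) (FCol : Type v) (n : ℕ) : Type (max 1 u v w) :=
  Dgm VCol FCol n × VCol → k

section Operad

variable {k : Type w} {VCol : Type u} {FCol : Type v}

/-- The right action of a permutation on `U(n)`, induced by the action on `Dgm(n)`. -/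
def U.permute {n : ℕ} (q : U k VCol FCol n) (σ : Equiv.Perm (Fin n)) : U k VCol FCol n :=
  fun x => q (σ • x.1, x.2)

/-- The partial composition `q'' ∘_i q'` in `U(m)`, `m = n - 1 + j`, of `q''` in `U(n)` and `q'` in
`U(j)`: `q(Γ,K) = ∑ L, q'(Γ_J,L) q''(Γ/(J,L),K)`, where `J` is the set of the `j` consecutive
vertices of `Γ` the first of which has number `i`. -/
noncomputable def U.comp [CommRing k] [Fintype VCol] {n j m : ℕ+}
    (hm : (m : ℕ) + 1 = n + j) (i : Fin n) (q'' : U k VCol FCol n) (q' : U k VCol FCol j) :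
    U k VCol FCol m :=
  have hcard : ∀ G : Diagram VCol FCol m, (G.segment i j).card = j := fun G =>
    G.card_segment i j (by have := i.isLt; omega)
  have hne : ∀ G : Diagram VCol FCol m, (G.segment i j).Nonempty := fun G =>
    Finset.card_pos.1 (by rw [hcard G]; exact j.pos)
  fun x => Quotient.liftOn x.1
    (fun G => ∑ L : VCol,
      q' ((G.restrict (G.segment i j) (hcard G)).toDgm, L) *
      q'' ((G.contract (G.segment i j) (hne G) L (by rw [hcard G, hm])).toDgm, x.2))
    (by
      rintro G G' ⟨e⟩
      have hseg : ∀ y, e.onV y ∈ G'.segment i j ↔ y ∈ G.segment i j := fun y => by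
        rw [Diagram.mem_segment, Diagram.mem_segment, e.enu_comm]
      refine Finset.sum_congr rfl fun L _ => ?_
      have h1 : (G.restrict (G.segment i j) (hcard G)).toDgm =
          (G'.restrict (G'.segment i j) (hcard G')).toDgm :=
        Quotient.sound (Diagram.restrict_equiv e _ _ hseg _ _)
      have h2 : (G.contract (m := n) (G.segment i j) (hne G) L (by rw [hcard G, hm])).toDgm =
          (G'.contract (m := n) (G'.segment i j) (hne G') L (by rw [hcard G', hm])).toDgm :=
        Quotient.sound (Diagram.contract_equiv e _ _ hseg _ _ _ _ _)
      rw [h1, h2])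

/-- A system of submodules `P(n)` of `U(n)`, `n ≥ 1`, is a suboperad if it is stable under the
actions of the permutation groups and under all partial compositions. No operadic unit is
required. -/
structure IsSuboperad [CommRing k] [Fintype VCol]
    (P : ∀ n : ℕ+, Submodule k (U k VCol FCol n)) : Prop where
  permute_mem : ∀ (n : ℕ+) (σ : Equiv.Perm (Fin n)) (q : U k VCol FCol n),
    q ∈ P n → q.permute σ ∈ P n
  comp_mem : ∀ (n j m : ℕ+) (hm : (m : ℕ) + 1 = n + j) (i : Fin n) (q'' : U k VCol FCol n)
    (q' : U k VCol FCol j), q'' ∈ P n → q' ∈ P j → U.comp hm i q'' q' ∈ P m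

/-- The submodule `U_S(n) = k^{S(n)}` of the functions vanishing outside `S(n)`. -/
def subspace (k : Type w) [CommRing k] {n : ℕ} (S : Set (Dgm VCol FCol n × VCol)) :
    Submodule k (U k VCol FCol n) where
  carrier := {q | ∀ x, x ∉ S → q x = 0}
  add_mem' := fun {a b} ha hb x hx => by simp [ha x hx, hb x hx]
  zero_mem' := fun _ _ => rfl
  smul_mem' := fun c q hq x hx => by simp [hq x hx]

/-- `S(n)` is invariant under the permutation group acting on the first factor of
`Dgm(n) × VCol`. -/
def PermInvariant {n : ℕ} (S : Set (Dgm VCol FCol n × VCol)) : Prop :=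
  ∀ (σ : Equiv.Perm (Fin n)) (x : Dgm VCol FCol n × VCol), x ∈ S → (σ • x.1, x.2) ∈ S

/-- For every `Γ` with `n` vertices and every nonempty set `J` of vertices of `Γ`, and all colors
`K`, `L`: if `(Γ_J,L) ∈ S(|J|)` and `(Γ/(J,L),K) ∈ S(n-|J|+1)` then `(Γ,K) ∈ S(n)`. Here `j` and `m`
are names for the positive numbers `|J|` and `n-|J|+1`. -/
def ContractionClosed (S : ∀ n : ℕ+, Set (Dgm VCol FCol n × VCol)) : Prop :=
  ∀ (n j m : ℕ+) (G : Diagram VCol FCol n) (J : Finset G.V) (hJ : J.Nonempty)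
    (hj : J.card = j) (hm : (m : ℕ) + J.card = n + 1) (K L : VCol),
    ((G.restrict J hj).toDgm, L) ∈ S j → ((G.contract J hJ L hm).toDgm, K) ∈ S m →
    (G.toDgm, K) ∈ S n

end Operad

end Contraction

namespace Contraction

namespace Diagram

variable {VCol : Type u} {FCol : Type v}

/-! Closure of `S` implies closure of the subspaces term by term: if `(Γ,K)` lies outside `S`, then
for each `L` one of `(Γ_J,L)`, `(Γ/(J,L),K)` lies outside `S`, so every summand of the composite
vanishes at `(Γ,K)` (`isSuboperad_subspace`).

Conversely, suboperads are tested on indicator functions. Permuting an indicator gives invariance of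
`S`. Composing the indicators of `(Γ_J,L)` and `(Γ/(J,L),K)` gives a function with value exactly `1`
at `(Γ,K)`, since the color recorded in the first indicator singles out one summand; as `1 ≠ 0` in
`k`, this forces `(Γ,K)` into `S`.

The obstacle is that partial compositions only see sets `J` of consecutive vertices, whereas the
closure condition allows any nonempty `J`. Renumbering makes `J` an initial segment
(`exists_segment_relabel_eq`) and changes `Γ_J` and `Γ/(J,L)` only by renumberings, which the
invariance already proved absorbs. -/

theorem toDgm_relabel {n : ℕ} (σ : Equiv.Perm (Fin n)) (G : Diagram VCol FCol n) :
    (G.relabel σ).toDgm = σ • G.toDgm :=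
  rfl

/-- The numbering of `G` enters `restrict` only through `enu`, so both sides have the same
underlying graph and `τ` just compares two enumerations. An explicit formula for `τ` is never
needed. The same argument serves for `contract`. -/
theorem exists_restrict_relabel {n m : ℕ} (σ : Equiv.Perm (Fin n)) (G : Diagram VCol FCol n)
    (J : Finset G.V) (hm : J.card = m) :
    ∃ τ : Equiv.Perm (Fin m),
      ((G.relabel σ).restrict J hm).toDgm = τ • (G.restrict J hm).toDgm := by
  refine ⟨(G.restrict J hm).enu.symm.trans ((G.relabel σ).restrict J hm).enu, ?_⟩
  rw [← toDgm_relabel]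
  refine Quotient.sound ⟨⟨Equiv.refl _, Equiv.refl _, fun _ => rfl, fun _ => rfl, fun _ => rfl,
    fun _ => rfl, fun x => ?_⟩⟩
  exact congrArg ((G.relabel σ).restrict J hm).enu ((G.restrict J hm).enu.symm_apply_apply x)

theorem exists_contract_relabel {n m : ℕ} (σ : Equiv.Perm (Fin n)) (G : Diagram VCol FCol n)
    (J : Finset G.V) (hJ : J.Nonempty) (L : VCol) (hm : m + J.card = n + 1) :
    ∃ τ : Equiv.Perm (Fin m),
      ((G.relabel σ).contract J hJ L hm).toDgm = τ • (G.contract J hJ L hm).toDgm := by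
  refine ⟨(G.contract J hJ L hm).enu.symm.trans ((G.relabel σ).contract J hJ L hm).enu, ?_⟩
  rw [← toDgm_relabel]
  refine Quotient.sound ⟨⟨Equiv.refl _, Equiv.refl _, fun _ => rfl, fun _ => rfl, fun _ => rfl,
    fun _ => rfl, fun x => ?_⟩⟩
  exact congrArg ((G.relabel σ).contract J hJ L hm).enu
    ((G.contract J hJ L hm).enu.symm_apply_apply x)

/-- Any set of vertices becomes an initial segment after a suitable renumbering. -/
theorem exists_segment_relabel_eq {n : ℕ} (G : Diagram VCol FCol n) (J : Finset G.V) :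
    ∃ σ : Equiv.Perm (Fin n), (G.relabel σ).segment 0 J.card = J := by
  have hle : J.card ≤ n := by
    simpa using Finset.card_le_univ (J.map G.enu.toEmbedding)
  have hcard : Fintype.card {l : Fin n // l ∈ J.map G.enu.toEmbedding} =
      Fintype.card {l : Fin n // (l : ℕ) < J.card} := by
    have h := Fintype.card_congr (Fin.castLEquiv hle)
    rw [Fintype.card_fin] at h
    simpa using h
  -- Any bijection from the labels of `J` onto the labels below `J.card` extends to a permutation of
  -- `Fin n`.
  let σ : Equiv.Perm (Fin n) := (Fintype.equivOfCardEq hcard).extendSubtype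
  refine ⟨σ, ?_⟩
  refine Finset.ext fun (x : G.V) => (mem_segment (G.relabel σ) 0 J.card x).trans
    (Iff.trans ?_ (Finset.mem_map' G.enu.toEmbedding))
  rw [zero_add]
  change 0 ≤ (σ (G.enu x) : ℕ) ∧ (σ (G.enu x) : ℕ) < J.card ↔ G.enu x ∈ _
  refine ⟨fun h => ?_, fun h => ⟨Nat.zero_le _, ?_⟩⟩
  · by_contra hn
    exact (Fintype.equivOfCardEq hcard).extendSubtype_not_mem _ hn h.2
  · exact (Fintype.equivOfCardEq hcard).extendSubtype_mem _ h

end Diagram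

section Operad

variable {k : Type w} [CommRing k] {VCol : Type u} {FCol : Type v}

/-- Keeping `J` as a variable equal to the segment lets the formula apply to a given vertex set,
known only propositionally to be a segment, without transporting dependent types. -/
theorem U.comp_apply [Fintype VCol] {n j m : ℕ+} (hm : (m : ℕ) + 1 = n + j) (i : Fin n)
    (q'' : U k VCol FCol n) (q' : U k VCol FCol j) (G : Diagram VCol FCol m) (K : VCol)
    {J : Finset G.V} (hseg : G.segment i j = J) (hJ : J.Nonempty) (hj : J.card = j)
    (hn : (n : ℕ) + J.card = m + 1) :
    U.comp hm i q'' q' (G.toDgm, K) =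
      ∑ L : VCol, q' ((G.restrict J hj).toDgm, L) * q'' ((G.contract J hJ L hn).toDgm, K) := by
  subst hseg
  rfl

open Classical in
theorem single_mem_subspace {n : ℕ} {S : Set (Dgm VCol FCol n × VCol)}
    {x : Dgm VCol FCol n × VCol} (hx : x ∈ S) : (Pi.single x 1 : U k VCol FCol n) ∈ subspace k S :=
  fun _ hy => Pi.single_eq_of_ne (ne_of_mem_of_not_mem hx hy).symm _

theorem IsSuboperad.permInvariant [Nontrivial k] [Fintype VCol]
    {S : ∀ n : ℕ+, Set (Dgm VCol FCol n × VCol)}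
    (h : IsSuboperad fun n : ℕ+ => subspace k (S n)) (n : ℕ+) : PermInvariant (S n) := by
  classical
  intro σ x hx
  by_contra hn
  -- The indicator of `x`, permuted by `σ⁻¹`, has value `1` at `σ • x`.
  have h0 := h.permute_mem n σ⁻¹ _ (single_mem_subspace (k := k) hx) _ hn
  simp [U.permute] at h0

theorem IsSuboperad.contractionClosed [Nontrivial k] [Fintype VCol]
    {S : ∀ n : ℕ+, Set (Dgm VCol FCol n × VCol)}
    (h : IsSuboperad fun n : ℕ+ => subspace k (S n)) : ContractionClosed S := by
  classical
  intro n j m G J hJ hj hm K L hres hcon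
  obtain ⟨σ, hσ⟩ := G.exists_segment_relabel_eq J
  obtain ⟨τ, hτ⟩ := G.exists_restrict_relabel σ J hj
  obtain ⟨ρ, hρ⟩ := G.exists_contract_relabel σ J hJ L hm
  have hres' := h.permInvariant j τ _ hres
  have hcon' := h.permInvariant m ρ _ hcon
  rw [← hτ] at hres'
  rw [← hρ] at hcon'
  -- Renumbering back by `σ⁻¹` returns to `G`.
  suffices hG : ((G.relabel σ).toDgm, K) ∈ S n by
    simpa [Diagram.toDgm_relabel] using h.permInvariant n σ⁻¹ _ hG
  by_contra hn
  -- Insertion at position `0`, because `σ` moved `J` to the initial segment; the contracted graph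
  -- gives the outer factor, the restricted one the inner factor.
  have h0 := h.comp_mem m j n (by omega) ⟨0, m.pos⟩ _ _
    (single_mem_subspace (k := k) hcon') (single_mem_subspace (k := k) hres') _ hn
  rw [U.comp_apply (J := J) _ _ _ _ (G.relabel σ) K (by rw [← hj]; exact hσ) hJ hj hm,
    Finset.sum_eq_single L] at h0
  · simp at h0
  · intro L' _ hL'
    rw [Pi.single_eq_of_ne (fun he => hL' (congrArg Prod.snd he)), zero_mul]
  · exact fun hL => absurd (Finset.mem_univ L) hL

theorem isSuboperad_subspace [Fintype VCol] {S : ∀ n : ℕ+, Set (Dgm VCol FCol n × VCol)}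
    (hperm : ∀ n : ℕ+, PermInvariant (S n)) (hS : ContractionClosed S) :
    IsSuboperad fun n : ℕ+ => subspace k (S n) where
  permute_mem n σ q hq x hx := hq _ fun hn => hx (by simpa using hperm n σ⁻¹ _ hn)
  comp_mem n j m hm i q'' q' hq'' hq' := by
    rintro ⟨x, K⟩ hx
    induction x using Quotient.inductionOn with | h G => ?_
    have hj : (G.segment i j).card = j := G.card_segment i j (by have := i.isLt; omega)
    have hJ : (G.segment i j).Nonempty := Finset.card_pos.1 (by rw [hj]; exact j.pos)
    have hn : (n : ℕ) + (G.segment i j).card = m + 1 := by rw [hj, hm]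
    refine (U.comp_apply hm i q'' q' G K rfl hJ hj hn).trans
      (Finset.sum_eq_zero fun L _ => ?_)
    -- By the contrapositive of closure, either `q'` or `q''` is evaluated outside `S`.
    by_cases hres : ((G.restrict (G.segment i j) hj).toDgm, L) ∈ S j
    · rw [hq'' _ fun hcon => hx (hS m j n G _ hJ hj hn K L hres hcon), mul_zero]
    · rw [hq' _ hres, zero_mul]

end Operad

end Contraction

theorem mainTheorem5 {k : Type w} [CommRing k] [Nontrivial k] {VCol : Type u} [Fintype VCol]
    {FCol : Type v} (S : ∀ n : ℕ+, Set (Contraction.Dgm VCol FCol n × VCol)) :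
    Contraction.IsSuboperad (fun n : ℕ+ => Contraction.subspace k (S n)) ↔
      (∀ n : ℕ+, Contraction.PermInvariant (S n)) ∧ Contraction.ContractionClosed S :=
  ⟨fun h => ⟨h.permInvariant, h.contractionClosed⟩,
    fun h => Contraction.isSuboperad_subspace h.1 h.2⟩
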